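/- All groups are abelian and written additively; matroids have a finite ground set $E(M)$. For a map $\psi\colon E(M)\to\Gamma$ to a group (a group labeling) and $B\subseteq E(M)$, write $\psi(B)=\sum_{e\in B}\psi(e)$. A matroid is $\mathrm{GF}(q)$-representable if there is a matrix over $\mathrm{GF}(q)$ with columns indexed by $E(M)$ such that the bases of $M$ are exactly the sets of elements whose columns form a basis of the column space. A matroid of rank $r$ is paving if every circuit has size $r$ or $r+1$, and sparse paving if it and its dual are both paving. Corollary 5.7. Let $\mathcal{M}$ be either (1) the class of $\mathrm{GF}(q)$-representable matroids for a fixed prime power $q$, or (2) the class of sparse paving matroids. Then there is a computable function $d\colon\mathbb{N}\to\mathbb{N}$ such that the following holds for every $k\in\mathbb{N}$ (including $k=0$), every $M\in\mathcal{M}$, all group labelings $\psi_i\colon E(M)\to\Gamma_i$ and group elements $f_i\in\Gamma_i$ $(i=1,\dots,k)$, and every basis $A$ of $M$: if $M$ has at least one basis $B'$ with $\psi_i(B')\neq f_i$ for all $i\in\{1,\dots,k\}$, then $M$ has a basis $B$ with $\psi_i(B)\neq f_i$ for all $i\in\{1,\dots,k\}$ and $|A\setminus B|\le d(k)$. -/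

import Mathlib

namespace Matroid

/-- `M` is `F`-representable: there is a matrix over `F` whose columns are indexed by the elements
of `M` (columns with an index outside the ground set are ignored), such that the bases of `M` are
exactly the sets of elements whose columns form a basis of the span of all the columns. -/
def IsRepresentableOver {α : Type*} (F : Type*) [Field F] (M : Matroid α) : Prop :=
  ∃ (m : ℕ) (A : Matrix (Fin m) α F), ∀ B : Set α,
    M.IsBase B ↔ B ⊆ M.E ∧ LinearIndepOn F A.col B ∧
      Submodule.span F (A.col '' B) = Submodule.span F (A.col '' M.E)

/-- A matroid of rank `r` is paving if each of its circuits has `r` or `r + 1` elements. -/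
def IsPaving {α : Type*} (M : Matroid α) : Prop :=
  ∀ C : Set α, M.IsCircuit C → C.encard = M.eRank ∨ C.encard = M.eRank + 1

/-- A matroid is sparse paving if it and its dual are both paving. -/
def IsSparsePaving {α : Type*} (M : Matroid α) : Prop :=
  M.IsPaving ∧ M✶.IsPaving

/-- `B` is a basis of `M` such that `ψ i (B) = ∑ e ∈ B, ψ i e` differs from `f i` for all `i`. -/
def IsAvoidingBase {α : Type*} (M : Matroid α) {k : ℕ} {Γ : Fin k → Type*}
    [∀ i, AddCommGroup (Γ i)] (ψ : ∀ i, α → Γ i) (f : ∀ i, Γ i) (B : Finset α) : Prop :=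
  M.IsBase (B : Set α) ∧ ∀ i, ∑ e ∈ B, ψ i e ≠ f i

end Matroid

/-! Let `B` be an avoiding basis far from `A`. It suffices to find y_0, y_1, … in `B \ A` and x_0,
x_1, … in `A \ B` such that exchanging y_j for x_j over any interval of indices, with ends at
multiples of some w, gives a basis. These bases are closer to `A`, so suppose that none of them
avoids. Then for each pair s < t of ends there is an i such that the prefix sums of ψ_i(x_j) -
ψ_i(y_j) differ by exactly h_i = f_i - ψ_i(B) ≠ 0. Colour the pair with i. A monochromatic triangle
would give h_i + h_i = h_i, so `card_le_triangleBound` limits the number of ends. Induction on the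
distance to `A` finishes the proof.

For sparse paving matroids w = 1 works, and the x_j are chosen greedily: each interval ending at the
new index rules out at most one candidate (`IsSparsePaving.isBase_insert_or`).

Over GF(q), the coefficients of `A \ B` on `B \ A` form a matrix of rank |A \ B|. Large rank forces
a large submatrix that is constant above, on and below the diagonal (`exists_threeValued_of_rank`).
Its diagonal blocks of size divisible by w = q(q - 1) are nonsingular (`det_threeValued_ne_zero`),
and a nonsingular block makes the exchange a basis. -/

/-- An upper bound for the number of vertices of a complete graph that has an edge colouring with
`k` colours and without monochromatic triangle. -/
def triangleBound : ℕ → ℕ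
  | 0 => 1
  | k + 1 => (k + 1) * triangleBound k + 1

/-- If, for a sequence `c` in a product of groups and any two of the indices `s < t` in `T`,
some coordinate `i ∈ K` of `c t - c s` is the fixed nonzero element `h i`,
then the number of indices is bounded in terms of the number of coordinates. -/
theorem card_le_triangleBound {ι : Type*} [DecidableEq ι] {Γ : ι → Type*}
    [∀ i, AddCommGroup (Γ i)] (h : ∀ i, Γ i) (h0 : ∀ i, h i ≠ 0) (c : ℕ → ∀ i, Γ i) (n : ℕ) :
    ∀ (K : Finset ι) (T : Finset ℕ), K.card = n →
      (∀ s ∈ T, ∀ t ∈ T, s < t → ∃ i ∈ K, c t i - c s i = h i) → T.card ≤ triangleBound n := by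
  induction n with
  | zero =>
    intro K T hK hT
    rw [Finset.card_eq_zero] at hK
    subst hK
    refine Finset.card_le_one.2 fun a ha b hb => ?_
    by_contra hab
    rcases lt_or_gt_of_ne hab with hab | hab
    · simpa using hT a ha b hb hab
    · simpa using hT b hb a ha hab
  | succ n ih =>
    intro K T hK hT
    by_contra! hlt
    have hne : T.Nonempty := Finset.card_pos.1 (by lia)
    have hs := T.min'_mem hne
    set s := T.min' hne
    have hpos : ∀ t ∈ T.erase s, ∃ i ∈ K, c t i - c s i = h i := fun t ht =>
      hT s hs t (Finset.mem_of_mem_erase ht)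
        (lt_of_le_of_ne (T.min'_le t (Finset.mem_of_mem_erase ht)) (Finset.ne_of_mem_erase ht).symm)
    have : Nonempty ι := (Finset.card_pos.1 (by lia : 0 < K.card)).to_subtype.map Subtype.val
    choose! col hcol using hpos
    have hcard : K.card * triangleBound n < (T.erase s).card := by
      rw [Finset.card_erase_of_mem hs, hK]
      simp only [triangleBound] at hlt
      lia
    -- Pigeonhole on the colours of the pairs (s, t). Inside a large class of colour i, the colour i
    -- cannot recur, which leaves n colours.
    obtain ⟨i, hi, hfib⟩ := Finset.exists_lt_card_fiber_of_mul_lt_card_of_maps_to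
      (fun t ht => (hcol t ht).1) hcard
    refine hfib.not_ge (ih (K.erase i) _ (by rw [Finset.card_erase_of_mem hi, hK]; rfl) ?_)
    intro t ht u hu htu
    rw [Finset.mem_filter] at ht hu
    obtain ⟨j, hj, hju⟩ := hT t (Finset.mem_of_mem_erase ht.1) u (Finset.mem_of_mem_erase hu.1) htu
    refine ⟨j, Finset.mem_erase.2 ⟨?_, hj⟩, hju⟩
    rintro rfl
    have h1 := (hcol t ht.1).2
    have h2 := (hcol u hu.1).2
    rw [ht.2] at h1
    rw [hu.2] at h2
    apply h0 j
    rw [← sub_add_sub_cancel _ (c t j), hju, h1] at h2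
    simpa using h2

/-! ### Interval exchanges and the Ramsey argument -/

/-- The set obtained from `B` by exchanging the elements `y j` for the `x j`, `a ≤ j < b`. -/
def exchangeIco {α : Type*} [DecidableEq α] (B : Finset α) (y x : ℕ → α) (a b : ℕ) : Finset α :=
  (B \ (Finset.Ico a b).image y) ∪ (Finset.Ico a b).image x

/-- `x` and `y` are injective below `n`, with values in `A \ B` and in `B \ A`. -/
structure IsExchangeSeq {α : Type*} [DecidableEq α] (A B : Finset α) (y x : ℕ → α) (n : ℕ) :
    Prop where
  mem_y : ∀ j < n, y j ∈ B \ A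
  mem_x : ∀ j < n, x j ∈ A \ B
  inj_y : ∀ i < n, ∀ j < n, y i = y j → i = j
  inj_x : ∀ i < n, ∀ j < n, x i = x j → i = j

namespace IsExchangeSeq

variable {α : Type*} [DecidableEq α] {A B : Finset α} {y x : ℕ → α} {n : ℕ}

theorem image_y_subset (h : IsExchangeSeq A B y x n) {a b : ℕ} (hb : b ≤ n) :
    (Finset.Ico a b).image y ⊆ B \ A := by
  intro e he
  obtain ⟨j, hj, rfl⟩ := Finset.mem_image.1 he
  exact h.mem_y j ((Finset.mem_Ico.1 hj).2.trans_le hb)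

theorem image_x_subset (h : IsExchangeSeq A B y x n) {a b : ℕ} (hb : b ≤ n) :
    (Finset.Ico a b).image x ⊆ A \ B := by
  intro e he
  obtain ⟨j, hj, rfl⟩ := Finset.mem_image.1 he
  exact h.mem_x j ((Finset.mem_Ico.1 hj).2.trans_le hb)

theorem sum_exchangeIco (h : IsExchangeSeq A B y x n) {a b : ℕ} (hb : b ≤ n)
    {Γ : Type*} [AddCommGroup Γ] (g : α → Γ) :
    ∑ e ∈ exchangeIco B y x a b, g e = ∑ e ∈ B, g e + ∑ j ∈ Finset.Ico a b, (g (x j) - g (y j)) := by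
  have hy := h.image_y_subset (a := a) hb
  have hx := h.image_x_subset (a := a) hb
  have hdisj : Disjoint (B \ (Finset.Ico a b).image y) ((Finset.Ico a b).image x) := by
    rw [Finset.disjoint_left]
    intro e he he'
    exact (Finset.mem_sdiff.1 (hx he')).2 (Finset.mem_sdiff.1 he).1
  have hyB : (Finset.Ico a b).image y ⊆ B := hy.trans Finset.sdiff_subset
  have hlt : ∀ {j}, j ∈ Finset.Ico a b → j < n := fun hj => (Finset.mem_Ico.1 hj).2.trans_le hb
  rw [exchangeIco, Finset.sum_union hdisj, Finset.sum_sdiff_eq_sub hyB,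
    Finset.sum_image (fun i hi j hj => h.inj_x i (hlt hi) j (hlt hj)),
    Finset.sum_image (fun i hi j hj => h.inj_y i (hlt hi) j (hlt hj)), Finset.sum_sub_distrib]
  abel

/-- The removed elements lie outside `A`, and `x a` is a gained element of `A`. -/
theorem card_sdiff_exchangeIco_lt (h : IsExchangeSeq A B y x n) {a b : ℕ} (hab : a < b)
    (hb : b ≤ n) : (A \ exchangeIco B y x a b).card < (A \ B).card := by
  have hy := h.image_y_subset (a := a) hb
  apply Finset.card_lt_card
  rw [Finset.ssubset_iff_of_subset]
  · refine ⟨x a, h.mem_x a (hab.trans_le hb), ?_⟩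
    have : x a ∈ (Finset.Ico a b).image x := Finset.mem_image_of_mem _ (by simpa using hab)
    simp only [exchangeIco, Finset.mem_sdiff, Finset.mem_union, not_and, not_not]
    exact fun _ => Or.inr this
  · intro e he
    simp only [exchangeIco, Finset.mem_sdiff, Finset.mem_union, not_or, not_and, not_not] at he ⊢
    exact ⟨he.1, fun heB => (Finset.mem_sdiff.1 (hy (he.2.1 heB))).2 he.1⟩

end IsExchangeSeq

namespace Matroid

/-- If all exchanges between two distinct multiples of `w` lead to bases, and there are many
of them, then one of these bases avoids all forbidden values. -/
theorem IsAvoidingBase.exists_card_sdiff_lt {α : Type*} [DecidableEq α] {M : Matroid α} {k : ℕ}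
    {Γ : Fin k → Type*} [∀ i, AddCommGroup (Γ i)] {ψ : ∀ i, α → Γ i} {f : ∀ i, Γ i}
    {A B : Finset α} (hB : M.IsAvoidingBase ψ f B) {w m : ℕ} (hw : 0 < w) {y x : ℕ → α}
    (hyx : IsExchangeSeq A B y x (w * m))
    (hbase : ∀ s t, s < t → t ≤ m → M.IsBase (exchangeIco B y x (w * s) (w * t) : Set α))
    (hm : triangleBound k ≤ m) :
    ∃ B', M.IsAvoidingBase ψ f B' ∧ (A \ B').card < (A \ B).card := by
  by_contra! hcon
  -- Prefix sums turn the interval changes into differences. The ends 0, …, m give m + 1 indices,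
  -- one more than the bound allows.
  let c : ℕ → ∀ i, Γ i := fun t i => ∑ j ∈ Finset.range (w * t), (ψ i (x j) - ψ i (y j))
  have key := card_le_triangleBound (fun i => f i - ∑ e ∈ B, ψ i e)
    (fun i => sub_ne_zero.2 (hB.2 i).symm) c k Finset.univ (Finset.range (m + 1)) (by simp) ?_
  · rw [Finset.card_range] at key
    lia
  · intro s _ t ht hst
    have htm : t ≤ m := Nat.lt_succ_iff.1 (Finset.mem_range.1 ht)
    have hlt : w * s < w * t := Nat.mul_lt_mul_of_pos_left hst hw
    have hle : w * t ≤ w * m := Nat.mul_le_mul_left w htm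
    have hna : ¬ M.IsAvoidingBase ψ f (exchangeIco B y x (w * s) (w * t)) := fun h =>
      (hcon _ h).not_gt (hyx.card_sdiff_exchangeIco_lt hlt hle)
    simp only [IsAvoidingBase, hbase s t hst htm, true_and, not_forall, not_not] at hna
    obtain ⟨i, hi⟩ := hna
    refine ⟨i, Finset.mem_univ i, ?_⟩
    rw [hyx.sum_exchangeIco hle, Finset.sum_Ico_eq_sub _ hlt.le] at hi
    simp only [c, ← hi]
    abel

/-- If long exchange sequences exist between any two distant bases, then some avoiding base is
close to a given base. -/
theorem exists_isAvoidingBase_card_sdiff_le {α : Type*} [DecidableEq α] {M : Matroid α} {k : ℕ}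
    {Γ : Fin k → Type*} [∀ i, AddCommGroup (Γ i)] {ψ : ∀ i, α → Γ i} {f : ∀ i, Γ i}
    {A : Finset α} {w d : ℕ} (hw : 0 < w)
    (hex : ∀ B : Finset α, M.IsBase (B : Set α) → d < (A \ B).card →
      ∃ y x, IsExchangeSeq A B y x (w * triangleBound k) ∧ ∀ s t, s < t → t ≤ triangleBound k →
        M.IsBase (exchangeIco B y x (w * s) (w * t) : Set α))
    (h : ∃ B, M.IsAvoidingBase ψ f B) :
    ∃ B, M.IsAvoidingBase ψ f B ∧ (A \ B).card ≤ d := by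
  obtain ⟨B, hB⟩ := h
  induction hn : (A \ B).card using Nat.strong_induction_on generalizing B with
  | _ n ih =>
    by_cases hd : (A \ B).card ≤ d
    · exact ⟨B, hB, hd⟩
    obtain ⟨y, x, hyx, hbase⟩ := hex B hB.1 (not_le.1 hd)
    obtain ⟨B', hB', hlt⟩ := hB.exists_card_sdiff_lt hw hyx hbase le_rfl
    exact ih _ (hn ▸ hlt) B' hB' rfl

/-! ### Sparse paving matroids -/

/-- In a sparse paving matroid, at most one element extends a set of rank size minus one to a
nonbasis. -/
theorem IsSparsePaving.isBase_insert_or {α : Type*} {M : Matroid α} [M.Finite]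
    (hM : M.IsSparsePaving) {C : Set α} (hC : C ⊆ M.E) (hcard : C.encard + 1 = M.eRank)
    {u v : α} (hu : u ∈ M.E) (hv : v ∈ M.E) (huC : u ∉ C) (hvC : v ∉ C) (huv : u ≠ v) :
    M.IsBase (insert u C) ∨ M.IsBase (insert v C) := by
  have hfin : C.encard ≠ ⊤ := (M.ground_finite.subset hC).encard_lt_top.ne
  have hCi : M.Indep C := by
    by_contra hd
    obtain ⟨D, hDC, hD⟩ := ((M.not_indep_iff hC).1 hd).exists_isCircuit_subset
    have h1 := Set.encard_le_encard hDC
    have h2 : C.encard < C.encard + 1 := ENat.lt_add_one_iff hfin |>.2 le_rfl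
    rcases hM.1 D hD with h | h
    · rw [h, ← hcard] at h1
      exact h2.not_ge h1
    · rw [h, ← hcard] at h1
      exact h2.not_ge (le_self_add.trans h1)
  have hbase : ∀ e, e ∉ C → M.Indep (insert e C) → M.IsBase (insert e C) := by
    intro e he hi
    obtain ⟨B, hB, hsub⟩ := hi.exists_isBase_superset
    have : B.encard ≤ (insert e C).encard := by
      rw [hB.encard_eq_eRank, Set.encard_insert_of_notMem he, hcard]
    rwa [(M.ground_finite.subset hi.subset_ground).eq_of_subset_of_encard_le hsub this]
  -- If both extensions fail, `u` and `v` lie in the closure of `C`. The complement of `C ∪ {u, v}`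
  -- has one element less than the dual rank, so it is coindependent and `C ∪ {u, v}` spans. Hence
  -- `C` spans, although it is too small.
  by_contra! hnb
  have hclos : ∀ e ∈ M.E, e ∉ C → ¬ M.IsBase (insert e C) → e ∈ M.closure C := by
    intro e heE he hn
    by_contra hcl
    exact hn (hbase e he ((hCi.insert_indep_iff_of_notMem he).2 ⟨heE, hcl⟩))
  have hucl := hclos u hu huC hnb.1
  have hvcl := hclos v hv hvC hnb.2
  set S := insert u (insert v C)
  have hSE : S ⊆ M.E := Set.insert_subset hu (Set.insert_subset hv hC)
  have hScard : S.encard = M.eRank + 1 := by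
    rw [Set.encard_insert_of_notMem (by simp [huv, huC]), Set.encard_insert_of_notMem hvC, hcard]
  have hTcard : (M.E \ S).encard + 1 = M✶.eRank := by
    have h1 := M.eRank_add_eRank_dual
    rw [← Set.encard_sdiff_add_encard_of_subset hSE, hScard, add_comm, ← add_assoc, add_right_comm]
      at h1
    have h3 : M.eRank ≠ ⊤ := by
      rw [← hcard]; simpa using hfin
    exact (WithTop.add_right_cancel h3 h1).symm
  have hTi : M✶.Indep (M.E \ S) := by
    by_contra hd
    obtain ⟨D, hDC, hD⟩ := ((M✶.not_indep_iff Set.sdiff_subset).1 hd).exists_isCircuit_subset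
    have h1 := Set.encard_le_encard hDC
    have h2 : (M.E \ S).encard < (M.E \ S).encard + 1 :=
      ENat.lt_add_one_iff (M.ground_finite.subset Set.sdiff_subset).encard_lt_top.ne |>.2 le_rfl
    rcases hM.2 D hD with h | h
    · rw [h, ← hTcard] at h1
      exact h2.not_ge h1
    · rw [h, ← hTcard] at h1
      exact h2.not_ge (le_self_add.trans h1)
  have hSs : M.Spanning S := by
    have := Coindep.compl_spanning (M := M) (I := M.E \ S) hTi
    rwa [Set.sdiff_sdiff_cancel_left hSE] at this
  have hScl : S ⊆ M.closure C := Set.insert_subset hucl (Set.insert_subset hvcl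
    (M.subset_closure C hC))
  have hCs : M.Spanning C := by
    rw [spanning_iff_closure_eq]
    refine (M.closure_subset_ground C).antisymm ?_
    rw [← hSs.closure_eq]
    exact M.closure_subset_closure_of_subset_closure hScl
  have := (hCi.isBase_of_spanning hCs).encard_eq_eRank
  rw [← hcard] at this
  exact (ENat.lt_add_one_iff hfin |>.2 le_rfl).ne this


/-- Between any two bases of a sparse paving matroid there is an exchange sequence, of half the
length of their difference, all of whose intervals lead to bases. -/
theorem IsSparsePaving.exists_isExchangeSeq {α : Type*} [DecidableEq α] {M : Matroid α} [M.Finite]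
    (hM : M.IsSparsePaving) {A B : Finset α} (hA : M.IsBase (A : Set α))
    (hB : M.IsBase (B : Set α)) {y : ℕ → α} (hy : ∀ j < (A \ B).card, y j ∈ B \ A)
    (hyinj : ∀ i < (A \ B).card, ∀ j < (A \ B).card, y i = y j → i = j) (m : ℕ)
    (hm : 2 * m ≤ (A \ B).card) :
    ∃ x, IsExchangeSeq A B y x m ∧ ∀ s t, s < t → t ≤ m →
      M.IsBase (exchangeIco B y x s t : Set α) := by
  induction m with
  | zero => exact ⟨y, ⟨by simp, by simp, by simp, by simp⟩, fun s t hst ht => by lia⟩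
  | succ m ih =>
    obtain ⟨x, hx, hbase⟩ := ih (by lia)
    -- The exchange over the interval from s to m, with the new element x_m still missing.
    let C : ℕ → Finset α := fun s =>
      (B \ (Finset.Ico s (m + 1)).image y) ∪ (Finset.Ico s m).image x
    have hyB : ∀ s, (Finset.Ico s (m + 1)).image y ⊆ B := by
      intro s e he
      obtain ⟨j, hj, rfl⟩ := Finset.mem_image.1 he
      rw [Finset.mem_Ico] at hj
      exact (Finset.mem_sdiff.1 (hy j (by lia))).1
    have hxA : ∀ s, (Finset.Ico s m).image x ⊆ A \ B := fun s => hx.image_x_subset le_rfl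
    have hCcard : ∀ s ≤ m, (C s).card + 1 = B.card := by
      intro s hs
      have hdisj : Disjoint (B \ (Finset.Ico s (m + 1)).image y) ((Finset.Ico s m).image x) := by
        rw [Finset.disjoint_left]
        intro e he he'
        exact (Finset.mem_sdiff.1 (hxA s he')).2 (Finset.mem_sdiff.1 he).1
      have h1 : ((Finset.Ico s (m + 1)).image y).card = m + 1 - s := by
        rw [Finset.card_image_of_injOn, Nat.card_Ico]
        intro i hi j hj
        simp only [Finset.coe_Ico, Set.mem_Ico] at hi hj
        exact hyinj i (by lia) j (by lia)
      have h2 : ((Finset.Ico s m).image x).card = m - s := by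
        rw [Finset.card_image_of_injOn, Nat.card_Ico]
        intro i hi j hj
        simp only [Finset.coe_Ico, Set.mem_Ico] at hi hj
        exact hx.inj_x i (by lia) j (by lia)
      have h3 := Finset.card_le_card (hyB s)
      rw [Finset.card_union_of_disjoint hdisj, Finset.card_sdiff_of_subset (hyB s), h1, h2]
      lia
    have hCE : ∀ s, (C s : Set α) ⊆ M.E := by
      intro s e he
      rcases Finset.mem_union.1 (Finset.mem_coe.1 he) with he | he
      · exact hB.subset_ground (Finset.mem_sdiff.1 he).1
      · exact hA.subset_ground (Finset.mem_sdiff.1 (hxA s he)).1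
    classical
    let bad : ℕ → Finset α := fun s => ((A \ B) \ (Finset.range m).image x).filter
      fun v => ¬ M.IsBase (insert v (C s : Set α))
    have hbad : ∀ s ∈ Finset.range (m + 1), (bad s).card ≤ 1 := by
      intro s hs
      refine Finset.card_le_one.2 fun u hu v hv => ?_
      by_contra huv
      simp only [bad, Finset.mem_filter, Finset.mem_sdiff] at hu hv
      have hnot : ∀ e, e ∉ B → e ∉ (Finset.range m).image x → e ∉ (C s : Set α) := by
        intro e h1 h2 h3
        rcases Finset.mem_union.1 (Finset.mem_coe.1 h3) with h3 | h3
        · exact h1 (Finset.mem_sdiff.1 h3).1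
        · refine h2 (Finset.image_subset_image ?_ h3)
          intro j hj
          rw [Finset.mem_Ico] at hj
          exact Finset.mem_range.2 hj.2
      have hrank : (C s : Set α).encard + 1 = M.eRank := by
        rw [← hB.encard_eq_eRank, Set.encard_coe_eq_coe_finsetCard, Set.encard_coe_eq_coe_finsetCard,
          ← hCcard s (by simpa [Nat.lt_succ_iff] using hs)]
        rfl
      rcases hM.isBase_insert_or (hCE s) hrank (hA.subset_ground hu.1.1.1)
        (hA.subset_ground hv.1.1.1) (hnot u hu.1.1.2 hu.1.2) (hnot v hv.1.1.2 hv.1.2) huv with h | h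
      · exact hu.2 h
      · exact hv.2 h
    -- At least 2(m + 1) - m = m + 2 candidates remain, and the m + 1 left ends exclude at most one
    -- each.
    have hlt : ((Finset.range (m + 1)).biUnion bad).card <
        ((A \ B) \ (Finset.range m).image x).card := by
      have h1 := Finset.card_biUnion_le_card_mul _ bad 1 hbad
      have h2 := Finset.le_card_sdiff ((Finset.range m).image x) (A \ B)
      have h3 : ((Finset.range m).image x).card ≤ m := by
        simpa using Finset.card_image_le (s := Finset.range m) (f := x)
      rw [Finset.card_range] at h1
      lia
    obtain ⟨v, hv, hvbad⟩ := Finset.exists_mem_notMem_of_card_lt_card hlt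
    have hgood : ∀ s ≤ m, M.IsBase (insert v (C s : Set α)) := by
      intro s hs
      by_contra hn
      exact hvbad (Finset.mem_biUnion.2 ⟨s, by simpa [Nat.lt_succ_iff] using hs,
        Finset.mem_filter.2 ⟨hv, hn⟩⟩)
    have hvx : ∀ j < m, x j ≠ v := by
      rintro j hj rfl
      exact (Finset.mem_sdiff.1 hv).2 (Finset.mem_image_of_mem _ (Finset.mem_range.2 hj))
    have hold : ∀ j < m, Function.update x m v j = x j := fun j hj =>
      Function.update_of_ne hj.ne _ _
    have hnew : Function.update x m v m = v := Function.update_self ..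
    have himg : ∀ s t, t ≤ m → (Finset.Ico s t).image (Function.update x m v) =
        (Finset.Ico s t).image x := by
      intro s t ht
      refine Finset.image_congr fun j hj => hold j ?_
      simp only [Finset.coe_Ico, Set.mem_Ico] at hj
      lia
    refine ⟨Function.update x m v, ⟨fun j hj => hy j (by lia), ?_,
      fun i hi j hj => hyinj i (by lia) j (by lia), ?_⟩, ?_⟩
    · intro j hj
      rcases Nat.lt_succ_iff_lt_or_eq.1 hj with hj | rfl
      · rw [hold j hj]
        exact hx.mem_x j hj
      · rw [hnew]
        exact (Finset.mem_sdiff.1 hv).1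
    · intro i hi j hj hij
      rcases Nat.lt_succ_iff_lt_or_eq.1 hi with hi | rfl <;>
        rcases Nat.lt_succ_iff_lt_or_eq.1 hj with hj | rfl
      · rw [hold i hi, hold j hj] at hij
        exact hx.inj_x i hi j hj hij
      · rw [hold i hi, hnew] at hij
        exact absurd hij (hvx i hi)
      · rw [hnew, hold j hj] at hij
        exact absurd hij.symm (hvx j hj)
      · rfl
    · intro s t hst ht
      rcases Nat.le_succ_iff.1 ht with ht | rfl
      · rw [exchangeIco, himg s t ht]
        exact hbase s t hst ht
      · have hsm : s ≤ m := Nat.lt_succ_iff.1 hst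
        have : exchangeIco B y (Function.update x m v) s (m + 1) = insert v (C s) := by
          rw [exchangeIco, Finset.insert_Ico_right_eq_Ico_add_one hsm |>.symm, Finset.image_insert,
            Finset.image_insert, hnew, himg s m le_rfl, Finset.union_insert, ← Finset.image_insert,
            Finset.insert_Ico_right_eq_Ico_add_one hsm]
        rw [this, Finset.coe_insert]
        exact hgood s hsm

end Matroid

/-! ### Matrices of large rank over finite fields -/

namespace Matrix

variable {ρ κ F : Type*} [Fintype κ] [DecidableEq ρ] [DecidableEq κ] [Field F]

omit [DecidableEq ρ] [DecidableEq κ] in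
theorem rank_add_le_add (M N : Matrix ρ κ F) : (M + N).rank ≤ M.rank + N.rank := by
  have h : LinearMap.range (M + N).mulVecLin ≤
      LinearMap.range M.mulVecLin ⊔ LinearMap.range N.mulVecLin := by
    rw [mulVecLin_add]
    exact LinearMap.range_add_le _ _
  exact (Submodule.finrank_mono h).trans (Submodule.finrank_add_le_finrank_add_finrank _ _)

omit [DecidableEq ρ] [DecidableEq κ] in
theorem rank_sum_le_sum {ι : Type*} (s : Finset ι) (M : ι → Matrix ρ κ F) :
    (∑ i ∈ s, M i).rank ≤ ∑ i ∈ s, (M i).rank := by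
  classical
  induction s using Finset.induction_on with
  | empty => simp
  | insert i s hi ih =>
    rw [Finset.sum_insert hi, Finset.sum_insert hi]
    exact (rank_add_le_add _ _).trans (Nat.add_le_add_left ih _)

/-- The matrix `N` with all entries outside of `Y × X` replaced by zero. -/
def mask (N : Matrix ρ κ F) (Y : Finset ρ) (X : Finset κ) : Matrix ρ κ F :=
  of fun i j => if i ∈ Y ∧ j ∈ X then N i j else 0

omit [DecidableEq ρ] [DecidableEq κ] in
-- Rank is subadditive, so one of the q summands carries at least 1/q of the rank. This is used to
-- split rows or columns by the value of an entry.
theorem exists_rank_mask_le_of_sum [Fintype F] (N : F → Matrix ρ κ F) :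
    ∃ b, (∑ b, N b).rank ≤ Fintype.card F * (N b).rank := by
  by_contra! h
  have h1 := rank_sum_le_sum Finset.univ N
  have h2 : ∑ b, Fintype.card F * (N b).rank < ∑ _b : F, (∑ b, N b).rank :=
    Finset.sum_lt_sum_of_nonempty Finset.univ_nonempty fun b _ => h b
  rw [← Finset.mul_sum, Finset.sum_const, Finset.card_univ, smul_eq_mul] at h2
  exact (lt_of_mul_lt_mul_left h2 (Nat.zero_le _)).not_ge h1

theorem exists_rank_mask_filter_col [Fintype F] [DecidableEq F] (N : Matrix ρ κ F) (Y : Finset ρ)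
    (X : Finset κ) (f : κ → F) :
    ∃ b, (N.mask Y X).rank ≤ Fintype.card F * (N.mask Y (X.filter fun j => f j = b)).rank := by
  have h : N.mask Y X = ∑ b, N.mask Y (X.filter fun j => f j = b) := by
    ext i j
    simp only [mask, sum_apply, of_apply, Finset.mem_filter, ← and_assoc, ite_and]
    rw [Finset.sum_ite_irrel]
    by_cases hi : i ∈ Y <;> by_cases hj : j ∈ X <;> simp [hi, hj]
  rw [h]
  exact exists_rank_mask_le_of_sum _

theorem exists_rank_mask_filter_row [Fintype F] [DecidableEq F] (N : Matrix ρ κ F) (Y : Finset ρ)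
    (X : Finset κ) (f : ρ → F) :
    ∃ b, (N.mask Y X).rank ≤ Fintype.card F * (N.mask (Y.filter fun i => f i = b) X).rank := by
  have h : N.mask Y X = ∑ b, N.mask (Y.filter fun i => f i = b) X := by
    ext i j
    simp only [mask, sum_apply, of_apply, Finset.mem_filter]
    by_cases hi : i ∈ Y <;> by_cases hj : j ∈ X <;> simp [hi, hj]
  rw [h]
  exact exists_rank_mask_le_of_sum _

/-- A submatrix of rank at least two has a nonconstant row. -/
theorem exists_ne_of_two_le_rank_mask (N : Matrix ρ κ F) (Y : Finset ρ) (X : Finset κ)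
    (h : 2 ≤ (N.mask Y X).rank) : ∃ i ∈ Y, ∀ b, ∃ j ∈ X, N i j ≠ b := by
  by_contra! hcon
  have : ∀ i, ∃ b, i ∈ Y → ∀ j ∈ X, N i j = b := by
    intro i
    by_cases hi : i ∈ Y
    · obtain ⟨b, hb⟩ := hcon i hi
      exact ⟨b, fun _ => hb⟩
    · exact ⟨0, fun h => absurd h hi⟩
  choose b hb using this
  -- Constant rows make the masked matrix an outer product, of rank at most one.
  have heq : N.mask Y X =
      vecMulVec (fun i => if i ∈ Y then b i else 0) (fun j => if j ∈ X then 1 else 0) := by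
    ext i j
    simp only [mask, of_apply, vecMulVec_apply]
    by_cases hi : i ∈ Y <;> by_cases hj : j ∈ X <;> simp [hi, hj]
    exact hb i hi j hj
  rw [heq] at h
  have := rank_vecMulVec_le (fun i => if i ∈ Y then b i else 0) (fun j => if j ∈ X then (1 : F) else 0)
  lia

/-- A matrix of large rank over a finite field contains a long sequence of nonconstant corners,
each of which is constant in its row to the right and in its column below. -/
theorem exists_corner_seq [Fintype F] [DecidableEq F] (N : Matrix ρ κ F) (L : ℕ) :
    ∀ (Y : Finset ρ) (X : Finset κ), 2 * Fintype.card F ^ (2 * L) ≤ (N.mask Y X).rank →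
      ∃ (y : ℕ → ρ) (x : ℕ → κ) (b c : ℕ → F), ∀ i < L, y i ∈ Y ∧ x i ∈ X ∧
        b i ≠ N (y i) (x i) ∧ ∀ j, i < j → j < L → N (y i) (x j) = b i ∧ N (y j) (x i) = c i := by
  have hq : 0 < Fintype.card F := Fintype.card_pos
  induction L with
  | zero =>
    intro Y X h
    obtain ⟨i, -, hi⟩ := exists_ne_of_two_le_rank_mask N Y X (by simpa using h)
    obtain ⟨j, -, -⟩ := hi 0
    exact ⟨fun _ => i, fun _ => j, 0, 0, by simp⟩
  | succ L ih =>
    intro Y X h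
    have h2 : 2 ≤ (N.mask Y X).rank := le_trans (Nat.le_mul_of_pos_right 2 (pow_pos hq _)) h
    -- Restricting to the columns with value `b₀` in row `y₀`, then to the rows with value `c₀` in
    -- column `x₀`, costs a factor q each time, hence q² per corner.
    obtain ⟨y₀, hy₀, hrow⟩ := exists_ne_of_two_le_rank_mask N Y X h2
    obtain ⟨b₀, hb₀⟩ := N.exists_rank_mask_filter_col Y X (fun j => N y₀ j)
    obtain ⟨x₀, hx₀, hne⟩ := hrow b₀
    obtain ⟨c₀, hc₀⟩ := N.exists_rank_mask_filter_row Y (X.filter fun j => N y₀ j = b₀)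
      (fun i => N i x₀)
    obtain ⟨y, x, b, c, hyx⟩ := ih (Y.filter fun i => N i x₀ = c₀)
      (X.filter fun j => N y₀ j = b₀) (by
        have h3 := h.trans (hb₀.trans (Nat.mul_le_mul_left _ hc₀))
        refine Nat.le_of_mul_le_mul_left (Nat.le_of_mul_le_mul_left ?_ hq) hq
        refine le_trans (le_of_eq ?_) h3
        ring)
    refine ⟨fun | 0 => y₀ | n + 1 => y n, fun | 0 => x₀ | n + 1 => x n,
      fun | 0 => b₀ | n + 1 => b n, fun | 0 => c₀ | n + 1 => c n, ?_⟩
    intro i hi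
    rcases i with _ | i
    · refine ⟨hy₀, hx₀, hne.symm, fun j hj hjL => ?_⟩
      rcases j with _ | j
      · lia
      · have := hyx j (by lia)
        exact ⟨(Finset.mem_filter.1 this.2.1).2, (Finset.mem_filter.1 this.1).2⟩
    · have := hyx i (by lia)
      refine ⟨(Finset.mem_filter.1 this.1).1, (Finset.mem_filter.1 this.2.1).1, this.2.2.1,
        fun j hj hjL => ?_⟩
      rcases j with _ | j
      · lia
      · exact this.2.2.2 j (by lia) (by lia)

/-- The function with value `b` above the diagonal, `d` on the diagonal and `c` below it. -/
def threeValued (b c d : F) (i j : ℕ) : F := if i < j then b else if j < i then c else d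

/-- A matrix of large rank over a finite field contains a large square submatrix with constant values
above, on and below the diagonal. -/
theorem exists_threeValued [Fintype ρ] [Fintype F] [DecidableEq F] (N : Matrix ρ κ F) (n : ℕ)
    (h : 2 * Fintype.card F ^ (2 * (Fintype.card F ^ 3 * n)) ≤ N.rank) :
    ∃ (y : ℕ → ρ) (x : ℕ → κ) (b c d : F), b ≠ d ∧
      ∀ i < n, ∀ j < n, N (y i) (x j) = threeValued b c d i j := by
  have huniv : N.mask Finset.univ Finset.univ = N := by
    ext i j
    simp [mask]
  rw [← huniv] at h
  obtain ⟨y, x, b, c, hyx⟩ := N.exists_corner_seq _ _ _ h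
  -- There are q³ possible triples, so n of the q³n corners share one.
  obtain ⟨⟨b₀, c₀, d₀⟩, -, hfib⟩ := Finset.exists_le_card_fiber_of_mul_le_card_of_maps_to
    (s := Finset.range (Fintype.card F ^ 3 * n)) (t := (Finset.univ : Finset (F × F × F))) (n := n)
    (f := fun i => (b i, c i, N (y i) (x i))) (fun _ _ => Finset.mem_univ _) Finset.univ_nonempty
    (by simp only [Finset.card_univ, Fintype.card_prod, Finset.card_range]; exact le_of_eq (by ring))
  set T := (Finset.range (Fintype.card F ^ 3 * n)).filter
    fun i => (b i, c i, N (y i) (x i)) = (b₀, c₀, d₀) with hT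
  rcases n.eq_zero_or_pos with rfl | hn
  · exact ⟨y, x, 0, 0, 1, zero_ne_one, by simp⟩
  obtain ⟨T', hT'T, hT'⟩ := Finset.exists_subset_card_eq hfib
  let e := T'.orderEmbOfFin hT'
  have he : ∀ i : Fin n, e i < Fintype.card F ^ 3 * n ∧ b (e i) = b₀ ∧ c (e i) = c₀ ∧
      N (y (e i)) (x (e i)) = d₀ := by
    intro i
    have := hT'T (T'.orderEmbOfFin_mem hT' i)
    rw [hT, Finset.mem_filter, Finset.mem_range] at this
    simpa using this
  let g : ℕ → ℕ := fun i => if hi : i < n then e ⟨i, hi⟩ else 0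
  have hg : ∀ i (hi : i < n), g i = e ⟨i, hi⟩ := fun i hi => dif_pos hi
  refine ⟨y ∘ g, x ∘ g, b₀, c₀, d₀, ?_, ?_⟩
  · have h0 := he ⟨0, hn⟩
    rw [← h0.2.1, ← h0.2.2.2]
    exact (hyx _ h0.1).2.2.1
  · intro i hi j hj
    simp only [Function.comp_apply, hg i hi, hg j hj, threeValued]
    have hi' := he ⟨i, hi⟩
    have hj' := he ⟨j, hj⟩
    rcases lt_trichotomy i j with hij | rfl | hij
    · rw [if_pos hij, ((hyx _ hi'.1).2.2.2 _ (e.strictMono (by exact hij)) hj'.1).1, hi'.2.1]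
    · simpa using hi'.2.2.2
    · rw [if_neg hij.not_gt, if_pos hij,
        ((hyx _ hj'.1).2.2.2 _ (e.strictMono (by exact hij)) hi'.1).2, hj'.2.2.1]

/-- One may choose the three values such that the resulting matrices of suitable sizes are
nonsingular. -/
theorem exists_threeValued_of_rank [Fintype ρ] [Fintype F] [DecidableEq F] (N : Matrix ρ κ F) (n : ℕ)
    (h : 2 * Fintype.card F ^ (2 * (Fintype.card F ^ 3 * (n + 1))) ≤ N.rank) :
    ∃ (y : ℕ → ρ) (x : ℕ → κ) (b c d : F), b ≠ d ∧ (c = d → d ≠ 0) ∧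
      ∀ i < n, ∀ j < n, N (y i) (x j) = threeValued b c d i j := by
  obtain ⟨y, x, b, c, d, hbd, hN⟩ := N.exists_threeValued (n + 1) h
  by_cases hcd : c = d → d ≠ 0
  · exact ⟨y, x, b, c, d, hbd, hcd, fun i hi j hj => hN i (by lia) j (by lia)⟩
  · push Not at hcd
    obtain ⟨rfl, rfl⟩ := hcd
    -- Here only the entries above the diagonal are nonzero. Reversing both orders with columns
    -- shifted by one moves the value `b` to the diagonal and below it; the shift uses up the spare
    -- index.
    refine ⟨fun i => y (n - 1 - i), fun j => x (n - j), 0, b, b, hbd.symm, fun _ => hbd, ?_⟩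
    intro i hi j hj
    rw [hN _ (by lia) _ (by lia)]
    simp only [threeValued]
    split_ifs <;> first | rfl | lia

omit [Fintype κ] [DecidableEq ρ] [DecidableEq κ] [Field F] in
-- For i < j, the rows i and j have the different entries `b` and `d` in column j.
theorem threeValued_left_injective {N : Matrix ρ κ F} {n : ℕ} {y : ℕ → ρ} {x : ℕ → κ}
    {b c d : F} (hbd : b ≠ d)
    (hN : ∀ i < n, ∀ j < n, N (y i) (x j) = threeValued b c d i j) :
    ∀ i < n, ∀ j < n, y i = y j → i = j := by
  have key : ∀ i j, i < j → j < n → y i ≠ y j := by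
    intro i j hij hj h
    have h1 := hN i (by lia) j hj
    rw [h, hN j hj j hj] at h1
    simp only [threeValued, lt_irrefl, if_false, if_pos hij] at h1
    exact hbd h1.symm
  intro i hi j hj h
  rcases lt_trichotomy i j with hij | hij | hij
  · exact absurd h (key i j hij hj)
  · exact hij
  · exact absurd h.symm (key j i hij hi)

omit [Fintype κ] [DecidableEq ρ] [DecidableEq κ] [Field F] in
theorem threeValued_right_injective {N : Matrix ρ κ F} {n : ℕ} {y : ℕ → ρ} {x : ℕ → κ}
    {b c d : F} (hbd : b ≠ d)
    (hN : ∀ i < n, ∀ j < n, N (y i) (x j) = threeValued b c d i j) :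
    ∀ i < n, ∀ j < n, x i = x j → i = j := by
  have key : ∀ i j, i < j → j < n → x i ≠ x j := by
    intro i j hij hj h
    have h1 := hN i (by lia) j hj
    rw [← h, hN i (by lia) i (by lia)] at h1
    simp only [threeValued, lt_irrefl, if_false, if_pos hij] at h1
    exact hbd h1.symm
  intro i hi j hj h
  rcases lt_trichotomy i j with hij | hij | hij
  · exact absurd h (key i j hij hj)
  · exact hij
  · exact absurd h.symm (key j i hij hi)

/-- Matrices with constant values above, on and below the diagonal are nonsingular if their size
is a multiple of `q * (q - 1)`, where `q` is the size of the field. -/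
theorem det_threeValued_ne_zero [Fintype F] {b c d : F} (hbd : b ≠ d) (hcd : c = d → d ≠ 0)
    {n : ℕ} (hn0 : 0 < n) (hn : Fintype.card F * (Fintype.card F - 1) ∣ n) :
    (of fun i j : Fin n => threeValued b c d i j).det ≠ 0 := by
  intro hdet
  obtain ⟨v, hv0, hv⟩ := exists_mulVec_eq_zero_iff.2 hdet
  apply hv0
  let u : ℕ → F := fun i => if hi : i < n then v ⟨i, hi⟩ else 0
  have hu : ∀ i : Fin n, u i = v i := fun i => dif_pos i.2
  have hsum : ∀ i < n, ∑ j ∈ Finset.range n, threeValued b c d i j * u j = 0 := by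
    intro i hi
    have := congrFun hv ⟨i, hi⟩
    simp only [mulVec, dotProduct, of_apply, Pi.zero_apply] at this
    rw [← Fin.sum_univ_eq_sum_range (fun j => threeValued b c d i j * u j), ← this]
    simp only [hu]
  have hdb : d - b ≠ 0 := sub_ne_zero.2 hbd.symm
  -- Consecutive rows differ only in two columns, so a kernel vector is a geometric progression with
  -- ratio `r`, and row 0 then decides whether it vanishes.
  set r := (d - c) / (d - b) with hr
  have hstep : ∀ i, i + 1 < n → u (i + 1) = r * u i := by
    intro i hi
    have h1 : ∑ j ∈ Finset.range n,
        ((if j = i then (d - c) * u i else 0) + if j = i + 1 then (b - d) * u (i + 1) else 0)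
        = ∑ j ∈ Finset.range n, threeValued b c d i j * u j -
          ∑ j ∈ Finset.range n, threeValued b c d (i + 1) j * u j := by
      rw [← Finset.sum_sub_distrib]
      refine Finset.sum_congr rfl fun j _ => ?_
      simp only [threeValued]
      rcases lt_trichotomy j i with h | rfl | h
      · rw [if_neg (by lia), if_neg (by lia), if_neg (by lia), if_pos (by lia), if_neg (by lia),
          if_pos (by lia)]
        ring
      · rw [if_pos rfl, if_neg (by lia), if_neg (by lia), if_neg (by lia), if_neg (by lia),
          if_pos (by lia)]
        ring
      · rcases (show j = i + 1 ∨ i + 1 < j by lia) with rfl | h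
        · rw [if_neg (by lia), if_pos rfl, if_pos (by lia), if_neg (by lia), if_neg (by lia)]
          ring
        · rw [if_neg (by lia), if_neg (by lia), if_pos (by lia), if_pos (by lia)]
          ring
    rw [hsum i (by lia), hsum (i + 1) hi, sub_zero, Finset.sum_add_distrib, Finset.sum_ite_eq',
      Finset.sum_ite_eq', if_pos (Finset.mem_range.2 (by lia)), if_pos (Finset.mem_range.2 hi)] at h1
    rw [hr, div_mul_eq_mul_div, eq_div_iff hdb]
    linear_combination -h1
  have hpow : ∀ i, i < n → u i = r ^ i * u 0 := by
    intro i
    induction i with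
    | zero => simp
    | succ i ih =>
      intro hi
      rw [hstep i hi, ih (by lia)]
      ring
  have hrow : (b * ∑ j ∈ Finset.range n, r ^ j + (d - b)) * u 0 = 0 := by
    have h1 : ∑ j ∈ Finset.range n, (b * (r ^ j * u 0) + if j = 0 then (d - b) * u 0 else 0)
        = ∑ j ∈ Finset.range n, threeValued b c d 0 j * u j := by
      refine Finset.sum_congr rfl fun j hj => ?_
      rw [← hpow j (Finset.mem_range.1 hj)]
      simp only [threeValued]
      rcases j.eq_zero_or_pos with rfl | h
      · simp
        ring
      · rw [if_neg h.ne', if_pos h, add_zero]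
    rw [hsum 0 hn0, Finset.sum_add_distrib, Finset.sum_ite_eq', if_pos (Finset.mem_range.2 hn0),
      ← Finset.mul_sum, ← Finset.sum_mul] at h1
    rw [← h1]
    ring
  -- The geometric sum is n = 0 in `F` if r = 1, since q divides n. It is 1 if r = 0, leaving `d`.
  -- Otherwise it is 0, since q - 1 divides n.
  have hcoef : b * ∑ j ∈ Finset.range n, r ^ j + (d - b) ≠ 0 := by
    by_cases hr1 : r = 1
    · have : (n : F) = 0 := by
        obtain ⟨m, rfl⟩ := hn
        simp
      simpa [hr1, this] using hdb
    by_cases hr0 : r = 0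
    · have hdc : c = d := by
        rw [hr, div_eq_zero_iff, or_iff_left hdb, sub_eq_zero] at hr0
        exact hr0.symm
      have : ∑ j ∈ Finset.range n, r ^ j = 1 := by
        rw [Finset.sum_eq_single_of_mem 0 (Finset.mem_range.2 hn0)]
        · simp
        · intro j _ hj
          simp [hr0, hj]
      rw [this]
      simpa using hcd hdc
    · have hrn : r ^ n = 1 := by
        obtain ⟨m, rfl⟩ := hn
        rw [mul_right_comm, mul_comm, pow_mul, FiniteField.pow_card_sub_one_eq_one r hr0, one_pow]
      have : ∑ j ∈ Finset.range n, r ^ j = 0 := by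
        have := geom_sum_mul r n
        rw [hrn, sub_self] at this
        exact (mul_eq_zero.1 this).resolve_right (sub_ne_zero.2 hr1)
      simpa [this] using hdb
  have hu0 : u 0 = 0 := (mul_eq_zero.1 hrow).resolve_left hcoef
  ext i
  rw [← hu i, hpow i i.2, hu0, mul_zero]
  rfl

end Matrix

/-! ### Computability of the bounds -/

theorem primrec_triangleBound : Primrec triangleBound := by
  have h : Primrec₂ fun n ih : ℕ => (n + 1) * ih + 1 :=
    Primrec.nat_add.comp (Primrec.nat_mul.comp (Primrec.succ.comp Primrec.fst) Primrec.snd)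
      (Primrec.const 1)
  refine (Primrec.nat_rec₁ 1 h).of_eq fun n => ?_
  induction n with
  | zero => rfl
  | succ n ih => simp only [triangleBound, ← ih]

/-- The distance bound for matroids representable over the field with `q` elements. -/
def representableBound (q k : ℕ) : ℕ :=
  2 * q ^ (2 * (q ^ 3 * (q * (q - 1) * triangleBound k + 1)))

theorem primrec_representableBound (q : ℕ) : Primrec (representableBound q) := by
  have hmul : ∀ (a : ℕ) {f : ℕ → ℕ}, Primrec f → Primrec fun k => a * f k := fun a _ hf =>
    Primrec.nat_mul.comp (Primrec.const a) hf
  have hpow : Primrec₂ fun a b : ℕ => a ^ b := Primrec₂.unpaired'.1 Nat.Primrec.pow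
  exact hmul 2 (hpow.comp (Primrec.const q)
    (hmul 2 (hmul _ (Primrec.succ.comp (hmul _ primrec_triangleBound)))))

/-! ### Exchanges and coefficient matrices -/

section LinearAlgebra

variable {α F V : Type*} [DecidableEq α] [Field F] [AddCommGroup V] [Module F V]

/-- If the coefficients of the `x j` in the vectors `y i` of a basis form a nonsingular matrix,
then the `y i` can be exchanged for the `x j`. -/
theorem span_le_span_exchangeIco {v : α → V} {N : α → α → F} {A B : Finset α} {y x : ℕ → α}
    {L : ℕ} (hyx : IsExchangeSeq A B y x L)
    (hN : ∀ e ∈ A, v e = ∑ b ∈ B, N b e • v b) (a n : ℕ) (hn : a + n ≤ L)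
    (hdet : (Matrix.of fun i j : Fin n => N (y (a + i)) (x (a + j))).det ≠ 0) :
    Submodule.span F (v '' (B : Set α)) ≤
      Submodule.span F (v '' (exchangeIco B y x a (a + n) : Set α)) := by
  set U : Matrix (Fin n) (Fin n) F := Matrix.of fun i j : Fin n => N (y (a + i)) (x (a + j))
    with hU
  set S := Submodule.span F (v '' (exchangeIco B y x a (a + n) : Set α)) with hS
  have hmem : ∀ e ∈ exchangeIco B y x a (a + n), v e ∈ S := fun e he =>
    Submodule.subset_span ⟨e, he, rfl⟩
  have hyB : (Finset.Ico a (a + n)).image y ⊆ B :=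
    (hyx.image_y_subset hn).trans Finset.sdiff_subset
  -- In the expansion of `v (x (a + j))` over `B`, the terms outside the removed block lie in `S`,
  -- hence so does the rest. Inverting `U` then recovers each removed vector.
  have hsumS : ∀ j : Fin n, ∑ i : Fin n, U i j • v (y (a + i)) ∈ S := by
    intro j
    have hxj : v (x (a + j)) ∈ S := hmem _ (Finset.mem_union_right _
      (Finset.mem_image_of_mem _ (Finset.mem_Ico.2 ⟨by lia, by lia⟩)))
    have h1 := hN (x (a + j)) (Finset.mem_sdiff.1 (hyx.mem_x _ (by lia))).1
    rw [← Finset.sum_sdiff hyB, Finset.sum_image (fun i hi j hj => by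
      simp only [Finset.coe_Ico, Set.mem_Ico] at hi hj
      exact hyx.inj_y i (by lia) j (by lia)), Finset.sum_Ico_eq_sum_range] at h1
    have h2 : ∑ i : Fin n, U i j • v (y (a + i)) =
        ∑ i ∈ Finset.range (a + n - a), N (y (a + i)) (x (a + j)) • v (y (a + i)) := by
      rw [Nat.add_sub_cancel_left,
        ← Fin.sum_univ_eq_sum_range (fun i => N (y (a + i)) (x (a + j)) • v (y (a + i)))]
      rfl
    rw [h2, eq_sub_of_add_eq' h1.symm]
    exact S.sub_mem hxj (S.sum_mem fun b hb =>
      S.smul_mem _ (hmem b (Finset.mem_union_left _ hb)))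
  have hyS : ∀ i : Fin n, v (y (a + i)) ∈ S := by
    intro l
    have h1 : U * U⁻¹ = 1 := Matrix.mul_nonsing_inv U (isUnit_iff_ne_zero.2 hdet)
    have h2 : v (y (a + l)) = ∑ j : Fin n, U⁻¹ j l • ∑ i : Fin n, U i j • v (y (a + i)) := by
      simp_rw [Finset.smul_sum, smul_smul]
      rw [Finset.sum_comm]
      simp_rw [← Finset.sum_smul]
      have h3 : ∀ i, ∑ j, U⁻¹ j l * U i j = (1 : Matrix (Fin n) (Fin n) F) i l := by
        intro i
        rw [← h1, Matrix.mul_apply]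
        exact Finset.sum_congr rfl fun j _ => mul_comm _ _
      simp [h3, Matrix.one_apply]
    rw [h2]
    exact S.sum_mem fun j _ => S.smul_mem _ (hsumS j)
  rw [Submodule.span_le]
  rintro _ ⟨b, hb, rfl⟩
  by_cases hby : b ∈ (Finset.Ico a (a + n)).image y
  · obtain ⟨j, hj, rfl⟩ := Finset.mem_image.1 hby
    rw [Finset.mem_Ico] at hj
    have := hyS ⟨j - a, by lia⟩
    rwa [Nat.add_sub_cancel' hj.1] at this
  · exact hmem b (Finset.mem_union_left _ (Finset.mem_sdiff.2 ⟨hb, hby⟩))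

theorem card_exchangeIco_le {A B : Finset α} {y x : ℕ → α} {L : ℕ}
    (hyx : IsExchangeSeq A B y x L) {a b : ℕ} (hb : b ≤ L) :
    (exchangeIco B y x a b).card ≤ B.card := by
  have hyB : (Finset.Ico a b).image y ⊆ B := (hyx.image_y_subset hb).trans Finset.sdiff_subset
  have h1 : ((Finset.Ico a b).image y).card = (Finset.Ico a b).card :=
    Finset.card_image_of_injOn fun i hi j hj => by
      simp only [Finset.coe_Ico, Set.mem_Ico] at hi hj
      exact hyx.inj_y i (by lia) j (by lia)
  have h2 : ((Finset.Ico a b).image x).card ≤ (Finset.Ico a b).card := Finset.card_image_le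
  have h3 := Finset.card_union_le (B \ (Finset.Ico a b).image y) ((Finset.Ico a b).image x)
  have h4 := Finset.card_le_card hyB
  rw [Finset.card_sdiff_of_subset hyB, h1] at h3
  rw [h1] at h4
  exact h3.trans (by lia)

omit [DecidableEq α] in
/-- A spanning set that is not larger than a basis is independent. -/
theorem linearIndepOn_of_span_le {v : α → V} {B B' : Finset α}
    (hB : LinearIndepOn F v (B : Set α)) (hcard : B'.card ≤ B.card)
    (hspan : Submodule.span F (v '' (B : Set α)) ≤ Submodule.span F (v '' (B' : Set α))) :
    LinearIndepOn F v (B' : Set α) := by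
  have h1 : Module.finrank F (Submodule.span F (v '' (B : Set α))) = B.card := by
    rw [Set.image_eq_range]
    simpa using finrank_span_eq_card hB
  have : Module.Finite F (Submodule.span F (v '' (B' : Set α))) :=
    Module.Finite.span_of_finite F (B'.finite_toSet.image v)
  have h2 := Submodule.finrank_mono hspan
  rw [h1, Set.image_eq_range] at h2
  refine linearIndependent_iff_card_le_finrank_span.2 ?_
  simpa [Set.finrank] using hcard.trans h2

/-- The coefficient matrix between two independent sets has full rank. -/
theorem rank_coeff_eq_card {v : α → V} {N : α → α → F} {A B : Finset α}
    (hA : LinearIndepOn F v (A : Set α))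
    (hN : ∀ e ∈ A, v e = ∑ b ∈ B, N b e • v b) :
    (Matrix.of fun (i : {e // e ∈ B \ A}) (j : {e // e ∈ A \ B}) => N i j).rank =
      (A \ B).card := by
  rw [Matrix.rank, LinearMap.finrank_range_of_inj]
  · simp
  rw [← LinearMap.ker_eq_bot, LinearMap.ker_eq_bot']
  intro u hu
  let u' : α → F := fun e => if he : e ∈ A \ B then u ⟨e, he⟩ else 0
  have hu' : ∀ j : {e // e ∈ A \ B}, u' j = u j := fun j => dif_pos j.2
  have hzero : ∀ b ∈ B \ A, ∑ e ∈ A \ B, N b e * u' e = 0 := by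
    intro b hb
    rw [← Finset.sum_coe_sort (A \ B)]
    simp only [hu']
    exact congrFun hu ⟨b, hb⟩
  have hsum : ∑ e ∈ A \ B, u' e • v e =
      ∑ b ∈ A ∩ B, (∑ e ∈ A \ B, N b e * u' e) • v b := by
    calc ∑ e ∈ A \ B, u' e • v e
        = ∑ e ∈ A \ B, ∑ b ∈ B, (N b e * u' e) • v b := by
          refine Finset.sum_congr rfl fun e he => ?_
          rw [hN e (Finset.mem_sdiff.1 he).1, Finset.smul_sum]
          exact Finset.sum_congr rfl fun b _ => by rw [smul_smul, mul_comm]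
      _ = ∑ b ∈ B, (∑ e ∈ A \ B, N b e * u' e) • v b := by
          rw [Finset.sum_comm]
          exact Finset.sum_congr rfl fun b _ => (Finset.sum_smul).symm
      _ = ∑ b ∈ A ∩ B, (∑ e ∈ A \ B, N b e * u' e) • v b := by
          refine (Finset.sum_subset Finset.inter_subset_right fun b hb hbA => ?_).symm
          rw [hzero b (Finset.mem_sdiff.2 ⟨hb, fun h => hbA (Finset.mem_inter.2 ⟨h, hb⟩)⟩),
            zero_smul]
  -- A kernel vector kills the coefficients on `B \ A`, so its combination of `A \ B` is also one of
  -- `A ∩ B`. The difference is a linear relation on `A`.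
  let g : α → F := fun e => if e ∈ B then -∑ e' ∈ A \ B, N e e' * u' e' else u' e
  have hg : ∑ e ∈ A, g e • v e = 0 := by
    rw [← Finset.sum_inter_add_sum_sdiff A B]
    have h1 : ∑ e ∈ A \ B, g e • v e = ∑ e ∈ A \ B, u' e • v e :=
      Finset.sum_congr rfl fun e he => by simp only [g, if_neg (Finset.mem_sdiff.1 he).2]
    have h2 : ∑ e ∈ A ∩ B, g e • v e = -∑ b ∈ A ∩ B, (∑ e ∈ A \ B, N b e * u' e) • v b := by
      rw [← Finset.sum_neg_distrib]
      exact Finset.sum_congr rfl fun e he => by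
        simp only [g, if_pos (Finset.mem_inter.1 he).2, neg_smul]
    rw [h1, h2, hsum, neg_add_cancel]
  have := linearIndepOn_finset_iff.1 hA g hg
  ext j
  have hj := Finset.mem_sdiff.1 j.2
  have h3 := this j hj.1
  simp only [g, if_neg hj.2, hu'] at h3
  exact h3

end LinearAlgebra

/-! ### Representable matroids and the conclusion -/

namespace Matroid

/-- In a matroid representable over a finite field, there are long exchange sequences between
distant bases for which all intervals of suitable lengths lead to bases. -/
theorem IsRepresentableOver.exists_isExchangeSeq {α F : Type*} [DecidableEq α] [Field F]
    [Fintype F] {M : Matroid α} (hM : M.IsRepresentableOver F) {A B : Finset α}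
    (hA : M.IsBase (A : Set α)) (hB : M.IsBase (B : Set α)) {w : ℕ}
    (hw : w = Fintype.card F * (Fintype.card F - 1)) {m : ℕ}
    (hm : 2 * Fintype.card F ^ (2 * (Fintype.card F ^ 3 * (w * m + 1))) ≤ (A \ B).card) :
    ∃ y x, IsExchangeSeq A B y x (w * m) ∧ ∀ s t, s < t → t ≤ m →
      M.IsBase (exchangeIco B y x (w * s) (w * t) : Set α) := by
  classical
  obtain ⟨r, D, hD⟩ := hM
  have hw0 : 0 < w := by
    have := Fintype.one_lt_card (α := F)
    rw [hw]
    exact Nat.mul_pos (by lia) (by lia)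
  obtain ⟨-, hBi, hBs⟩ := (hD B).1 hB
  have hcoef : ∀ e, ∃ c : α → F, e ∈ A → D.col e = ∑ b ∈ B, c b • D.col b := by
    intro e
    by_cases he : e ∈ A
    · have : D.col e ∈ Submodule.span F (D.col '' (B : Set α)) := by
        rw [hBs]
        exact Submodule.subset_span ⟨e, hA.subset_ground he, rfl⟩
      obtain ⟨c, hc⟩ :=
          (Submodule.mem_span_image_finset_iff_exists_fun' F).1 this
      exact ⟨c, fun _ => hc.symm⟩
    · exact ⟨0, fun h => absurd h he⟩
  choose c hc using hcoef
  let N : α → α → F := fun b e => c e b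
  have hN : ∀ e ∈ A, D.col e = ∑ b ∈ B, N b e • D.col b := fun e he => hc e he
  rw [← rank_coeff_eq_card ((hD A).1 hA).2.1 hN] at hm
  obtain ⟨y, x, b, c, d, hbd, hcd, hyx⟩ := Matrix.exists_threeValued_of_rank _ _ hm
  have hseq : IsExchangeSeq A B (fun i => (y i : α)) (fun i => (x i : α)) (w * m) :=
    ⟨fun i _ => (y i).2, fun i _ => (x i).2,
      fun i hi j hj h => Matrix.threeValued_left_injective hbd hyx i hi j hj (Subtype.ext h),
      fun i hi j hj h => Matrix.threeValued_right_injective hbd hyx i hi j hj (Subtype.ext h)⟩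
  refine ⟨_, _, hseq, fun s t hst ht => ?_⟩
  obtain ⟨n, rfl⟩ := Nat.exists_eq_add_of_lt hst
  rw [add_assoc] at ht ⊢
  have hle : w * s + w * (n + 1) ≤ w * m := by
    rw [← mul_add]
    exact Nat.mul_le_mul_left w ht
  rw [mul_add w s]
  -- Shifting both indices by `w * s` preserves their order, so the diagonal block has the same
  -- three-valued form.
  have hdet : (Matrix.of fun i j : Fin (w * (n + 1)) =>
      N (y (w * s + i)) (x (w * s + j))).det ≠ 0 := by
    convert Matrix.det_threeValued_ne_zero hbd hcd (n := w * (n + 1)) (by positivity)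
      (hw ▸ Dvd.intro _ rfl) using 3
    ext i j
    have := hyx (w * s + i) (by lia) (w * s + j) (by lia)
    simp only [Matrix.of_apply, Matrix.threeValued, add_lt_add_iff_left] at this ⊢
    exact this
  have hspan := span_le_span_exchangeIco hseq hN _ _ hle hdet
  have hsub : (exchangeIco B (fun i => (y i : α)) (fun i => (x i : α)) (w * s)
      (w * s + w * (n + 1)) : Set α) ⊆ M.E := by
    intro e he
    rcases Finset.mem_union.1 (Finset.mem_coe.1 he) with he | he
    · exact hB.subset_ground (Finset.mem_sdiff.1 he).1
    · exact hA.subset_ground (Finset.mem_sdiff.1 (hseq.image_x_subset hle he)).1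
  refine (hD _).2 ⟨hsub, linearIndepOn_of_span_le hBi (card_exchangeIco_le hseq hle) hspan,
    (Submodule.span_mono (Set.image_mono hsub)).antisymm ?_⟩
  rw [← hBs]
  exact hspan

end Matroid

theorem corollary5p7 :
    (∀ q : ℕ, IsPrimePow q →
      ∃ d : ℕ → ℕ, Computable d ∧
        ∀ (F : Type*) [Field F], Nat.card F = q →
        ∀ (α : Type*) [DecidableEq α] (M : Matroid α) [M.Finite], M.IsRepresentableOver F →
        ∀ (k : ℕ) (Γ : Fin k → Type*) [∀ i, AddCommGroup (Γ i)]
          (ψ : ∀ i, α → Γ i) (f : ∀ i, Γ i) (A : Finset α), M.IsBase (A : Set α) →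
          (∃ B' : Finset α, M.IsAvoidingBase ψ f B') →
          ∃ B : Finset α, M.IsAvoidingBase ψ f B ∧ (A \ B).card ≤ d k) ∧
    (∃ d : ℕ → ℕ, Computable d ∧
        ∀ (α : Type*) [DecidableEq α] (M : Matroid α) [M.Finite], M.IsSparsePaving →
        ∀ (k : ℕ) (Γ : Fin k → Type*) [∀ i, AddCommGroup (Γ i)]
          (ψ : ∀ i, α → Γ i) (f : ∀ i, Γ i) (A : Finset α), M.IsBase (A : Set α) →
          (∃ B' : Finset α, M.IsAvoidingBase ψ f B') →
          ∃ B : Finset α, M.IsAvoidingBase ψ f B ∧ (A \ B).card ≤ d k) := by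
  refine ⟨fun q hq => ⟨representableBound q, (primrec_representableBound q).to_comp, ?_⟩,
    fun k => 2 * triangleBound k,
    (Primrec.nat_mul.comp (Primrec.const 2) primrec_triangleBound).to_comp, ?_⟩
  · intro F _ hF α _ M _ hM k Γ _ ψ f A hA h
    have : Finite F := Nat.finite_of_card_ne_zero (hF ▸ hq.pos.ne')
    have := Fintype.ofFinite F
    rw [Nat.card_eq_fintype_card] at hF
    subst hF
    have h1 := Fintype.one_lt_card (α := F)
    exact Matroid.exists_isAvoidingBase_card_sdiff_le (Nat.mul_pos (by lia) (by lia))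
      (fun B hB hd => hM.exists_isExchangeSeq hA hB rfl hd.le) h
  · intro α _ M _ hM k Γ _ ψ f A hA h
    refine Matroid.exists_isAvoidingBase_card_sdiff_le one_pos (fun B hB hd => ?_) h
    have hcard : (A \ B).card = (B \ A).card := by
      have h1 := hA.encard_eq_encard_of_isBase hB
      rw [Set.encard_coe_eq_coe_finsetCard, Set.encard_coe_eq_coe_finsetCard, Nat.cast_inj] at h1
      rw [Finset.card_sdiff_comm h1]
    let e := (B \ A).equivFin
    have hpos : 0 < (B \ A).card := by lia
    -- An enumeration of `B \ A`, with its first element as default value.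
    let y : ℕ → α := fun j => if hj : j < (B \ A).card then e.symm ⟨j, hj⟩ else e.symm ⟨0, hpos⟩
    simp only [one_mul]
    refine ⟨y, hM.exists_isExchangeSeq hA hB (y := y) (fun j _ => ?_) (fun i hi j hj hij => ?_) _
      hd.le⟩
    · simp only [y]
      split_ifs <;> exact Subtype.coe_prop _
    · rw [hcard] at hi hj
      simp only [y, dif_pos hi, dif_pos hj] at hij
      simpa using e.symm.injective (Subtype.ext hij)
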